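/- Let $L=\mathbb Z\omega_1+\mathbb Z\omega_2\subset\mathbb C$ be a lattice, where $\omega_1,\omega_2$ are linearly independent over $\mathbb R$, let $$\wp(z;L)=\frac1{z^2}+\sum_{\omega\in L,\ \omega\neq0}\left(\frac1{(z-\omega)^2}-\frac1{\omega^2}\right)$$ be its Weierstrass function, and let $g_2(L)=60\sum_{\omega\in L,\ \omega\ne0}\omega^{-4}$ and $g_3(L)=140\sum_{\omega\in L,\ \omega\ne0}\omega^{-6}$. Put $h_2=\tfrac14 g_2(L)$ and $h_3=\tfrac14 g_3(L)$. Let $m$ be a positive integer and let $u\in\mathbb C$ be an $m$-division point of $L$, that is, $m u\in L$ but $u\notin L$. Then $m\cdot\wp(u;L)$ is integral over the ring $\mathbb Z[h_2,h_3]\subset\mathbb C$, i.e. it is a root of a monic polynomial with coefficients in $\mathbb Z[h_2,h_3]$. Moreover, if $m$ is even, then $\tfrac m2\cdot\wp(u;L)$ is also integral over $\mathbb Z[h_2,h_3]$. -/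

import Mathlib

/-! The `m`-th division polynomial of `Y² = X³ - h₂ X - h₃`, without its factor `ψ₂ = 2Y` when `m`
is even, has coefficients in `ℤ[h₂, h₃]` and leading coefficient `m` (odd `m`) or `m / 2` (even
`m`). A root times the leading coefficient is integral, so it suffices that `ψₘ` vanishes at `u`
(`divisionValue_eq_zero`). For even `m` the factor `℘'(u)` may vanish instead; then `℘(u)` is a root
of the monic cubic and is itself integral.

The vanishing follows from `ψₙ₊₂ ψₙ = ψₙ₊₁² (℘(z) - ℘((n+1)z))`: divided by `℘((n+1)z)`, it tends to
`0 = -ψₙ₊₁(u)²` at a point where `℘((n+1)z)` has a pole. To prove the relation, take it as the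
definition of a sequence (`ratioSeq`). The addition formula for `℘` (`weierstrassP_add`) shows that
this sequence obeys the elliptic recurrences, hence equals `normEDS`, which gives the division
polynomials (`ratioSeq_eq_normEDS`). -/

/-- The polynomial `Q(x, y, T)`, quadratic in `T`, whose roots are the `x`-coordinates of `P + P'`
and `P - P'`, for points `P` and `P'` with `x`-coordinates `x` and `y` on `Y² = X³ + a X + b`,
multiplied by `(x - y)²`. -/
def addSubPoly {R : Type*} [CommRing R] (a b x y T : R) : R :=
  (x - y) ^ 2 * T ^ 2 - 2 * ((x + y) * (x * y + a) + 2 * b) * T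
    + (x * y - a) ^ 2 - 4 * b * (x + y)

lemma map_addSubPoly {R S : Type*} [CommRing R] [CommRing S] (f : R →+* S) (a b x y T : R) :
    f (addSubPoly a b x y T) = addSubPoly (f a) (f b) (f x) (f y) (f T) := by
  simp [addSubPoly, map_ofNat]

/-- A sequence behaving like the `x`-coordinates of the multiples `nP` of a point `P` of infinite
order, with `2 * Y(P) = y`, on the curve `Y² = X³ + a X + b`. -/
structure IsMultipleSeq {K : Type*} [Field K] (a b y : K) (X : ℕ → K) : Prop where
  y_ne_zero : y ≠ 0
  y_sq : y ^ 2 = 4 * (X 1 ^ 3 + a * X 1 + b)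
  ne : ∀ n k, 0 < n → 0 < k → X n ≠ X (n + k)
  addSub : ∀ n k, 0 < n → 0 < k → ∀ T, (X (2 * n + k) - T) * (X k - T) * (X (n + k) - X n) ^ 2 =
    addSubPoly a b (X (n + k)) (X n) T

/-- The sequence with `b₁ = 1`, `b₂ = y` and `bₙ₊₁ bₙ₋₁ = bₙ² (X₁ - Xₙ)`. -/
def ratioSeq {K : Type*} [Field K] (y : K) (X : ℕ → K) : ℕ → K
  | 0 => 0
  | 1 => 1
  | 2 => y
  | n + 3 => ratioSeq y X (n + 2) ^ 2 * (X 1 - X (n + 2)) / ratioSeq y X (n + 1)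

/-! ### Elliptic recurrences from the addition law on `x`-coordinates -/

namespace IsMultipleSeq

variable {K : Type*} [Field K] {a b y : K} {X : ℕ → K}

lemma ratioSeq_ne_zero (h : IsMultipleSeq a b y X) : ∀ n, ratioSeq y X (n + 1) ≠ 0
  | 0 => by simp [ratioSeq]
  | 1 => by simpa [ratioSeq] using h.y_ne_zero
  | n + 2 => by
    have h1 := h.ratioSeq_ne_zero n
    have h2 := h.ratioSeq_ne_zero (n + 1)
    have h3 : X 1 - X (n + 2) ≠ 0 := by
      rw [show n + 2 = 1 + (n + 1) by ring]
      exact sub_ne_zero.2 (h.ne 1 (n + 1) one_pos n.succ_pos)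
    rw [ratioSeq]
    exact div_ne_zero (mul_ne_zero (pow_ne_zero _ h2) h3) h1

lemma ratioSeq_rec (h : IsMultipleSeq a b y X) (n : ℕ) :
    ratioSeq y X (n + 2) * ratioSeq y X n = ratioSeq y X (n + 1) ^ 2 * (X 1 - X (n + 1)) := by
  rcases n with _ | n
  · simp [ratioSeq]
  · rw [ratioSeq, div_mul_cancel₀ _ (h.ratioSeq_ne_zero n)]

/-- Duplication formula. `addSubPoly` is symmetric in `x, y, T`, and for `x = y` it is linear in
`T`; its root is `X 2`. -/
lemma addSub_two (h : IsMultipleSeq a b y X) (T : K) :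
    addSubPoly a b (X 1) (X 1) T = y ^ 2 * (X 2 - T) := by
  have := h.addSub 1 1 one_pos one_pos (X 1)
  simp only [Nat.reduceAdd, Nat.reduceMul] at this
  simp only [addSubPoly] at this ⊢
  linear_combination (X 2 - T) * h.y_sq * (-1) - this

/-- This mirrors `ψₚ₊ₙ ψₚ₋ₙ = ψₚ² ψₙ² (Xₙ - Xₚ)`. The cases `k = 1, 2` yield the doubling
recurrences of `normEDS`; general `k` is needed for the induction, which lowers `n` while raising
`k`. -/
lemma ratioSeq_add_mul_sub (h : IsMultipleSeq a b y X) : ∀ n k,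
    ratioSeq y X (2 * (n + 1) + k) * ratioSeq y X k =
      ratioSeq y X (n + 1 + k) ^ 2 * ratioSeq y X (n + 1) ^ 2 * (X (n + 1) - X (n + 1 + k))
  | n, 0 => by simp [ratioSeq]
  | 0, k + 1 => by
    have := h.ratioSeq_rec (k + 1)
    rw [show 2 * (0 + 1) + (k + 1) = k + 1 + 2 by ring, show 0 + 1 + (k + 1) = k + 1 + 1 by ring,
      this]
    simp [ratioSeq]
  | 1, k + 1 => by
    have h1 := h.ratioSeq_rec (k + 3)
    have h2 := h.ratioSeq_rec (k + 2)
    have h3 := h.ratioSeq_rec (k + 1)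
    have h4 := h.addSub 1 (k + 2) one_pos (by omega) (X 1)
    have h5 := h.addSub_two (X (k + 3))
    have n1 := h.ratioSeq_ne_zero (k + 2)
    simp only [show 2 * (1 + 1) + (k + 1) = k + 5 by ring, show 1 + 1 + (k + 1) = k + 3 by ring,
      show 2 * 1 + (k + 2) = k + 4 by ring, show 1 + (k + 2) = k + 3 by ring,
      show ratioSeq y X (1 + 1) = y from rfl, Nat.reduceAdd, add_assoc, addSubPoly]
      at h1 h2 h3 h4 h5 n1 ⊢
    apply mul_right_cancel₀ (pow_ne_zero 2 n1)
    set A := ratioSeq y X (k + 5)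
    set B := ratioSeq y X (k + 4)
    set C := ratioSeq y X (k + 3)
    set D := ratioSeq y X (k + 2)
    set E := ratioSeq y X (k + 1)
    linear_combination C * E * h1 + B ^ 2 * (X 1 - X (k + 4)) * h3
      + (B * D + C ^ 2 * (X 1 - X (k + 3))) * (X 1 - X (k + 4)) * (X 1 - X (k + 2)) * h2
      + C ^ 4 * h4 + C ^ 4 * h5
  | n + 2, k + 1 => by
    have h1 := h.ratioSeq_add_mul_sub (n + 1) (k + 2)
    have h2 := h.ratioSeq_add_mul_sub n (k + 3)
    have h3 := h.ratioSeq_rec (2 * n + k + 5)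
    have h4 := h.ratioSeq_rec (k + 1)
    have h5 := h.ratioSeq_rec (n + 1)
    have h6 := h.addSub (n + 2) (k + 2) (by omega) (by omega) (X 1)
    have h7 := h.addSub 1 (n + 1) (by omega) (by omega) (X (n + k + 4))
    have n1 := h.ratioSeq_ne_zero (2 * n + k + 4)
    have n2 := h.ratioSeq_ne_zero (k + 2)
    simp only [show 2 * (n + 2 + 1) + (k + 1) = 2 * n + k + 7 by ring,
      show n + 2 + 1 + (k + 1) = n + k + 4 by ring,
      show 2 * (n + 1 + 1) + (k + 2) = 2 * n + k + 6 by ring,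
      show n + 1 + 1 + (k + 2) = n + k + 4 by ring,
      show 2 * (n + 1) + (k + 3) = 2 * n + k + 5 by ring,
      show n + 1 + (k + 3) = n + k + 4 by ring,
      show 2 * 1 + (n + 1) = n + 3 by ring, show 1 + (n + 1) = n + 2 by ring,
      Nat.reduceAdd, add_assoc, addSubPoly] at h1 h2 h3 h4 h5 h6 h7 n1 n2 ⊢
    apply mul_right_cancel₀ (mul_ne_zero n1 n2)
    set A := ratioSeq y X (2 * n + (k + 7))
    set B := ratioSeq y X (2 * n + (k + 6))
    set C := ratioSeq y X (2 * n + (k + 5))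
    set G := ratioSeq y X (k + 3)
    set E := ratioSeq y X (k + 2)
    set D := ratioSeq y X (k + 1)
    set M := ratioSeq y X (n + (k + 4))
    set O := ratioSeq y X (n + 1)
    set N := ratioSeq y X (n + 2)
    set R := ratioSeq y X (n + 3)
    set s := X 1 - X (2 * n + (k + 6))
    set t := X 1 - X (k + 2)
    set w := X (n + 3) - X (n + (k + 4))
    set q := X (n + 1) - X (n + (k + 4))
    set p := X (n + 2) - X (n + (k + 4)) with hp
    set r := X 1 - X (n + 2) with hr
    -- `h6` and `h7` have equal right-hand sides because `addSubPoly` is symmetric in its last three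
    -- arguments.
    have h8 : s * t * p ^ 2 = w * q * r ^ 2 := by
      linear_combination h6 - h7
    linear_combination G * D * h3 + B ^ 2 * s * h4 + (B * E + M ^ 2 * (N ^ 2 * p)) * s * t * h1
      + M ^ 4 * N ^ 4 * h8 - (M ^ 2 * R ^ 2 * w * h2 + M ^ 4 * w * q * (R * O + N ^ 2 * r) * h5)

lemma ratioSeq_three (h : IsMultipleSeq a b y X) :
    ratioSeq y X 3 = 3 * X 1 ^ 4 + 6 * a * X 1 ^ 2 + 12 * b * X 1 - a ^ 2 := by
  have h1 := h.ratioSeq_rec 1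
  have h2 := h.addSub_two 0
  simp only [show ratioSeq y X 1 = 1 from rfl, show ratioSeq y X (1 + 1) = y from rfl,
    Nat.reduceAdd, addSubPoly] at h1 h2
  linear_combination h1 + h2 + X 1 * h.y_sq

lemma ratioSeq_four (h : IsMultipleSeq a b y X) :
    ratioSeq y X 4 = 2 * (X 1 ^ 6 + 5 * a * X 1 ^ 4 + 20 * b * X 1 ^ 3 - 5 * a ^ 2 * X 1 ^ 2
      - 4 * a * b * X 1 - 8 * b ^ 2 - a ^ 3) * y := by
  have h1 := h.ratioSeq_rec 1
  have h2 := h.ratioSeq_rec 2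
  have h3 := h.addSub_two 0
  have h4 := h.addSub 1 1 one_pos one_pos (X 1)
  -- The quadratic has roots `X 1` and `X 3`; its value at `X 1 + 1` isolates `X 3`.
  have h5 := h.addSub 1 1 one_pos one_pos (X 1 + 1)
  have hy := h.y_sq
  simp only [show ratioSeq y X 1 = 1 from rfl, show ratioSeq y X 2 = y from rfl,
    Nat.reduceAdd, Nat.reduceMul, addSubPoly] at h1 h2 h3 h4 h5
  apply mul_right_cancel₀ h.y_ne_zero
  rw [h2, show ratioSeq y X 3 = y ^ 2 * (X 1 - X 2) by linear_combination h1]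
  have h6 : (X 1 - X 3) * (X 1 - X 2) ^ 2 = 2 * X 1 * (X 1 - X 2) ^ 2
      - 2 * ((X 2 + X 1) * (X 2 * X 1 + a) + 2 * b) := by
    linear_combination h5 - h4
  linear_combination y ^ 4 * h6 + y ^ 2 * (6 * X 1 ^ 2 + 2 * a) * h3
    + y ^ 2 * (2 * X 1 ^ 3 - 2 * a * X 1 - 4 * b) * hy

lemma ratioSeq_eq_normEDS (h : IsMultipleSeq a b y X) (n : ℕ) :
    ratioSeq y X n = normEDS y (3 * X 1 ^ 4 + 6 * a * X 1 ^ 2 + 12 * b * X 1 - a ^ 2)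
      (2 * (X 1 ^ 6 + 5 * a * X 1 ^ 4 + 20 * b * X 1 ^ 3 - 5 * a ^ 2 * X 1 ^ 2
      - 4 * a * b * X 1 - 8 * b ^ 2 - a ^ 3)) n := by
  set c := 3 * X 1 ^ 4 + 6 * a * X 1 ^ 2 + 12 * b * X 1 - a ^ 2 with hc
  set d := 2 * (X 1 ^ 6 + 5 * a * X 1 ^ 4 + 20 * b * X 1 ^ 3 - 5 * a ^ 2 * X 1 ^ 2
      - 4 * a * b * X 1 - 8 * b ^ 2 - a ^ 3) with hd
  have hb := h.ratioSeq_rec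
  induction n using Nat.strong_induction_on with
  | _ n ih =>
    by_cases hn : n < 5
    · interval_cases n
      · simp [ratioSeq]
      · simp [ratioSeq]
      · simp [ratioSeq]
      · exact h.ratioSeq_three.trans (normEDS_three ..).symm
      · exact h.ratioSeq_four.trans (normEDS_four ..).symm
    · obtain ⟨m, rfl | rfl⟩ : ∃ m, n = 2 * (m + 3) ∨ n = 2 * (m + 2) + 1 := by
        obtain ⟨k, hk⟩ := n.even_or_odd'
        rcases hk with hk | hk
        · exact ⟨k - 3, by omega⟩
        · exact ⟨k - 2, by omega⟩
      · apply mul_right_cancel₀ h.y_ne_zero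
        have e := normEDS_even y c d ((m + 3 : ℕ) : ℤ)
        rw [show ((m + 3 : ℕ) : ℤ) - 1 = (m + 2 : ℕ) by push_cast; ring,
          show ((m + 3 : ℕ) : ℤ) + 2 = (m + 5 : ℕ) by push_cast; ring,
          show ((m + 3 : ℕ) : ℤ) - 2 = (m + 1 : ℕ) by push_cast; ring,
          show ((m + 3 : ℕ) : ℤ) + 1 = (m + 4 : ℕ) by push_cast; ring,
          ← ih (m + 2) (by omega), ← ih (m + 3) (by omega), ← ih (m + 5) (by omega),
          ← ih (m + 1) (by omega), ← ih (m + 4) (by omega)] at e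
        rw [Nat.cast_mul, Nat.cast_ofNat, e]
        have h1 := h.ratioSeq_add_mul_sub (m + 1) 2
        have h2 := hb (m + 3)
        have h3 := hb (m + 1)
        rw [show 2 * (m + 1 + 1) + 2 = 2 * (m + 3) by ring, show m + 1 + 1 + 2 = m + 4 by ring,
          show ratioSeq y X 2 = y from rfl] at h1
        rw [h1]
        linear_combination - ratioSeq y X (m + 2) ^ 2 * h2 + ratioSeq y X (m + 4) ^ 2 * h3
      · have e := normEDS_odd y c d ((m + 2 : ℕ) : ℤ)
        rw [show ((m + 2 : ℕ) : ℤ) - 1 = (m + 1 : ℕ) by push_cast; ring,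
          show ((m + 2 : ℕ) : ℤ) + 2 = (m + 4 : ℕ) by push_cast; ring,
          show ((m + 2 : ℕ) : ℤ) + 1 = (m + 3 : ℕ) by push_cast; ring,
          ← ih (m + 2) (by omega), ← ih (m + 3) (by omega), ← ih (m + 4) (by omega),
          ← ih (m + 1) (by omega)] at e
        rw [Nat.cast_add, Nat.cast_mul, Nat.cast_ofNat, Nat.cast_one, e]
        have h1 := h.ratioSeq_add_mul_sub (m + 1) 1
        have h2 := hb (m + 2)
        have h3 := hb (m + 1)
        rw [show ratioSeq y X 1 = 1 from rfl, mul_one] at h1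
        rw [h1]
        linear_combination - ratioSeq y X (m + 2) ^ 2 * h2 + ratioSeq y X (m + 3) ^ 2 * h3

end IsMultipleSeq

open Filter Topology

/-! ### Identity theorem for meromorphic functions -/

lemma Meromorphic.eventually_eq_zero_of_frequently {f : ℂ → ℂ} (hf : Meromorphic f) {x : ℂ}
    (h : ∃ᶠ z in 𝓝[≠] x, f z = 0) (u : ℂ) : ∀ᶠ z in 𝓝[≠] u, f z = 0 := by
  have hx : ∀ᶠ z in 𝓝[≠] x, f z = 0 :=
    (hf x).eventually_eq_zero_or_eventually_ne_zero.resolve_right fun h' ↦ h h'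
  rw [← meromorphicOrderAt_eq_top_iff] at hx ⊢
  by_contra hu
  exact MeromorphicOn.meromorphicOrderAt_ne_top_of_isPreconnected (U := Set.univ)
    (fun z _ ↦ hf z) isPreconnected_univ (Set.mem_univ u) (Set.mem_univ x) hu hx

lemma Meromorphic.eq_zero_of_frequently {f : ℂ → ℂ} (hf : Meromorphic f) {x : ℂ}
    (h : ∃ᶠ z in 𝓝[≠] x, f z = 0) {u : ℂ} (hu : ContinuousAt f u) : f u = 0 := by
  have h1 : Tendsto f (𝓝[≠] u) (𝓝 (f u)) := hu.tendsto.mono_left nhdsWithin_le_nhds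
  have h2 : Tendsto f (𝓝[≠] u) (𝓝 0) :=
    tendsto_const_nhds.congr' ((hf.eventually_eq_zero_of_frequently h u).mono fun _ hz ↦ hz.symm)
  exact tendsto_nhds_unique h1 h2

lemma Meromorphic.comp_analytic {f g : ℂ → ℂ} (hf : Meromorphic f) (hg : ∀ z, AnalyticAt ℂ g z) :
    Meromorphic fun z ↦ f (g z) :=
  fun z ↦ (hf (g z)).comp_analyticAt (hg z)

/-- The finite limit makes the singularity removable, and the extension has zero derivative on a
ball. -/
lemma eventually_eq_of_tendsto_of_hasDerivAt_zero {g : ℂ → ℂ} {x l : ℂ}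
    (hg : ∀ᶠ z in 𝓝[≠] x, HasDerivAt g 0 z) (hl : Tendsto g (𝓝[≠] x) (𝓝 l)) :
    ∀ᶠ z in 𝓝[≠] x, g z = l := by
  set k := Function.update g x l with hk
  have hkd : ∀ᶠ z in 𝓝[≠] x, HasDerivAt k 0 z := by
    filter_upwards [hg, self_mem_nhdsWithin] with z hz hzx
    exact hz.congr_of_eventuallyEq ((eventually_ne_nhds hzx).mono fun w hw ↦
      Function.update_of_ne hw _ _)
  have hkc : ContinuousAt k x := continuousAt_update_same.2 hl
  have hka : AnalyticAt ℂ k x :=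
    Complex.analyticAt_of_differentiable_on_punctured_nhds_of_continuousAt
      (hkd.mono fun z hz ↦ hz.differentiableAt) hkc
  have h0 : deriv k x = 0 := by
    have h1 : Tendsto (deriv k) (𝓝[≠] x) (𝓝 (deriv k x)) :=
      hka.deriv.continuousAt.tendsto.mono_left nhdsWithin_le_nhds
    exact tendsto_nhds_unique h1 (tendsto_const_nhds.congr' (hkd.mono fun z hz ↦ hz.deriv.symm))
  have h1 : ∀ᶠ z in 𝓝 x, AnalyticAt ℂ k z ∧ deriv k z = 0 := by
    refine hka.eventually_analyticAt.and ?_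
    rw [eventually_nhdsWithin_iff] at hkd
    filter_upwards [hkd] with z hz
    by_cases hzx : z = x
    · rw [hzx, h0]
    · exact (hz hzx).deriv
  obtain ⟨r, hr, hball⟩ := Metric.eventually_nhds_iff_ball.1 h1
  filter_upwards [nhdsWithin_le_nhds (Metric.ball_mem_nhds x hr), self_mem_nhdsWithin] with z hz hzx
  have := Metric.isOpen_ball.is_const_of_deriv_eq_zero (convex_ball x r).isPreconnected
    (fun w hw ↦ (hball w hw).1.differentiableAt.differentiableWithinAt)
    (fun w hw ↦ (hball w hw).2) hz (Metric.mem_ball_self hr)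
  rwa [hk, Function.update_of_ne hzx, Function.update_self] at this

/-! ### Poles, differential equations and addition formula of `℘` -/

namespace PeriodPair

variable (L : PeriodPair)

lemma eventually_notMem_lattice (x : ℂ) : ∀ᶠ z in 𝓝[≠] x, z ∉ L.lattice := by
  filter_upwards [nhdsWithin_le_nhds (L.compl_lattice_sdiff_singleton_mem_nhds x),
    self_mem_nhdsWithin] with z hz hzx hzL
  exact hz ⟨hzL, hzx⟩

lemma eventually_nhds_notMem_lattice {x : ℂ} (hx : x ∉ L.lattice) :
    ∀ᶠ z in 𝓝 x, z ∉ L.lattice :=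
  L.isClosed_lattice.isOpen_compl.mem_nhds hx

lemma tendsto_weierstrassP_cobounded {x : ℂ} (hx : x ∈ L.lattice) :
    Tendsto ℘[L] (𝓝[≠] x) (Bornology.cobounded ℂ) := by
  apply tendsto_cobounded_of_meromorphicOrderAt_neg
  rw [L.order_weierstrassP x hx]
  decide

lemma hasDerivAt_weierstrassP {z : ℂ} (hz : z ∉ L.lattice) : HasDerivAt ℘[L] (℘'[L] z) z := by
  rw [← L.deriv_weierstrassP]
  exact (L.analyticOnNhd_weierstrassP z hz).differentiableAt.hasDerivAt

lemma tendsto_inv_weierstrassP {x : ℂ} (hx : x ∈ L.lattice) :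
    Tendsto (fun z ↦ (℘[L] z)⁻¹) (𝓝[≠] x) (𝓝 0) :=
  tendsto_inv₀_cobounded.comp (L.tendsto_weierstrassP_cobounded hx)

lemma eventually_weierstrassP_ne {x : ℂ} (hx : x ∈ L.lattice) (c : ℂ) :
    ∀ᶠ z in 𝓝[≠] x, ℘[L] z ≠ c :=
  (L.tendsto_weierstrassP_cobounded hx).eventually (Bornology.eventually_ne_cobounded c)

lemma tendsto_derivWeierstrassP_div_sq {x : ℂ} (hx : x ∈ L.lattice) :
    Tendsto (fun z ↦ ℘'[L] z / ℘[L] z ^ 2) (𝓝[≠] x) (𝓝 0) := by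
  have ht := L.tendsto_inv_weierstrassP hx
  have h1 : Tendsto (fun z ↦ (℘'[L] z / ℘[L] z ^ 2) ^ 2) (𝓝[≠] x) (𝓝 0) := by
    have h2 : Tendsto (fun z ↦ 4 * (℘[L] z)⁻¹ - L.g₂ * (℘[L] z)⁻¹ ^ 3 - L.g₃ * (℘[L] z)⁻¹ ^ 4)
        (𝓝[≠] x) (𝓝 (4 * 0 - L.g₂ * 0 ^ 3 - L.g₃ * 0 ^ 4)) :=
      ((ht.const_mul 4).sub ((ht.pow 3).const_mul _)).sub ((ht.pow 4).const_mul _)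
    simp only [mul_zero, ne_eq, OfNat.ofNat_ne_zero, not_false_eq_true, zero_pow, sub_zero] at h2
    refine h2.congr' ?_
    filter_upwards [L.eventually_notMem_lattice x, L.eventually_weierstrassP_ne hx 0] with z hz hz0
    rw [div_pow, L.derivWeierstrassP_sq z hz]
    field_simp
  rw [tendsto_zero_iff_norm_tendsto_zero] at h1 ⊢
  have h2 := h1.sqrt
  rw [Real.sqrt_zero] at h2
  exact h2.congr fun z ↦ by rw [norm_pow, Real.sqrt_sq (norm_nonneg _)]

lemma eventually_derivWeierstrassP_ne_zero {x : ℂ} (hx : x ∈ L.lattice) :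
    ∀ᶠ z in 𝓝[≠] x, ℘'[L] z ≠ 0 := by
  have ht := L.tendsto_inv_weierstrassP hx
  have h2 : Tendsto (fun z ↦ 4 - L.g₂ * (℘[L] z)⁻¹ ^ 2 - L.g₃ * (℘[L] z)⁻¹ ^ 3)
      (𝓝[≠] x) (𝓝 (4 - L.g₂ * 0 ^ 2 - L.g₃ * 0 ^ 3)) :=
    (tendsto_const_nhds.sub ((ht.pow 2).const_mul _)).sub ((ht.pow 3).const_mul _)
  filter_upwards [L.eventually_notMem_lattice x, L.eventually_weierstrassP_ne hx 0,
    h2.eventually_ne (by norm_num : _ ≠ (0 : ℂ))] with z hz hz0 h h'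
  apply h
  have := L.derivWeierstrassP_sq z hz
  rw [h'] at this
  field_simp
  linear_combination -this

/-- Differentiate the cubic equation and cancel `℘'`, which is nonzero near the pole at `0`; the
identity theorem covers the remaining points. -/
lemma deriv_derivWeierstrassP {z : ℂ} (hz : z ∉ L.lattice) :
    deriv ℘'[L] z = 6 * ℘[L] z ^ 2 - L.g₂ / 2 := by
  have hm : Meromorphic fun z ↦ deriv ℘'[L] z - (6 * ℘[L] z ^ 2 - L.g₂ / 2) := by fun_prop
  have ha := L.analyticOnNhd_derivWeierstrassP z hz
  have hc : ContinuousAt (fun z ↦ deriv ℘'[L] z - (6 * ℘[L] z ^ 2 - L.g₂ / 2)) z := by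
    have h1 := ha.deriv.continuousAt
    have h2 := (L.analyticOnNhd_weierstrassP z hz).continuousAt
    fun_prop
  refine sub_eq_zero.1 (hm.eq_zero_of_frequently (x := 0) (Eventually.frequently ?_) hc)
  filter_upwards [L.eventually_notMem_lattice 0,
    L.eventually_derivWeierstrassP_ne_zero L.lattice.zero_mem] with w hw hw0
  have h1 := (L.analyticOnNhd_derivWeierstrassP w hw).differentiableAt.hasDerivAt
  have h2 := L.hasDerivAt_weierstrassP hw
  have h3 := (h1.pow 2)
  have h4 := (((h2.pow 3).const_mul 4).sub (h2.const_mul L.g₂)).sub_const L.g₃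
  have h5 := h3.congr_of_eventuallyEq (f₁ := fun z ↦ 4 * ℘[L] z ^ 3 - L.g₂ * ℘[L] z - L.g₃)
    ((L.eventually_nhds_notMem_lattice hw).mono fun v hv ↦ (L.derivWeierstrassP_sq v hv).symm)
  have h6 := h5.unique h4
  apply mul_left_cancel₀ hw0
  simp only [Nat.cast_ofNat, Nat.add_one_sub_one, pow_one] at h6
  linear_combination h6 / 2

lemma hasDerivAt_derivWeierstrassP {z : ℂ} (hz : z ∉ L.lattice) :
    HasDerivAt ℘'[L] (6 * ℘[L] z ^ 2 - L.g₂ / 2) z := by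
  rw [← L.deriv_derivWeierstrassP hz]
  exact (L.analyticOnNhd_derivWeierstrassP z hz).differentiableAt.hasDerivAt

lemma eventually_addition_formula {c : ℂ} (hc : c ∉ L.lattice) : ∀ᶠ u in 𝓝[≠] 0,
    4 * (℘[L] c + ℘[L] u + ℘[L] (c - u)) * (℘[L] u - ℘[L] (c - u)) ^ 2 = (℘'[L] u - ℘'[L] (c - u)) ^ 2 := by
  have hcu : ∀ᶠ u in 𝓝[≠] (0 : ℂ), c - u ∉ L.lattice := by
    have : Tendsto (fun u ↦ c - u) (𝓝[≠] 0) (𝓝 c) := by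
      have : ContinuousAt (fun u ↦ c - u) 0 := by fun_prop
      simpa using this.tendsto.mono_left nhdsWithin_le_nhds
    exact this.eventually (L.eventually_nhds_notMem_lattice hc)
  have hx₂ : Tendsto (fun u ↦ ℘[L] (c - u)) (𝓝[≠] 0) (𝓝 (℘[L] c)) := by
    have : ContinuousAt (fun u ↦ ℘[L] (c - u)) 0 :=
      ContinuousAt.comp (g := ℘[L]) (by simpa using (L.analyticOnNhd_weierstrassP c hc).continuousAt)
        (by fun_prop)
    simpa using this.tendsto.mono_left nhdsWithin_le_nhds
  have hy₂ : Tendsto (fun u ↦ ℘'[L] (c - u)) (𝓝[≠] 0) (𝓝 (℘'[L] c)) := by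
    have : ContinuousAt (fun u ↦ ℘'[L] (c - u)) 0 :=
      ContinuousAt.comp (g := ℘'[L]) (by simpa using (L.analyticOnNhd_derivWeierstrassP c hc).continuousAt)
        (by fun_prop)
    simpa using this.tendsto.mono_left nhdsWithin_le_nhds
  have h0 := L.lattice.zero_mem
  have ht := L.tendsto_inv_weierstrassP h0
  have hw := L.tendsto_derivWeierstrassP_div_sq h0
  have hne : ∀ᶠ u in 𝓝[≠] (0 : ℂ), 1 - ℘[L] (c - u) * (℘[L] u)⁻¹ ≠ 0 := by
    have := (tendsto_const_nhds (x := (1 : ℂ))).sub (hx₂.mul ht)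
    exact this.eventually_ne (by simp)
  have hne' : ∀ᶠ u in 𝓝[≠] (0 : ℂ), ℘[L] u - ℘[L] (c - u) ≠ 0 := by
    filter_upwards [hne, L.eventually_weierstrassP_ne h0 0] with u h1 h2 h3
    apply h1
    field_simp
    rw [h3, mul_zero]
  suffices ∀ᶠ u in 𝓝[≠] 0,
      ((℘'[L] u - ℘'[L] (c - u)) / (℘[L] u - ℘[L] (c - u))) ^ 2 / 4 - ℘[L] u - ℘[L] (c - u) = ℘[L] c by
    filter_upwards [this, hne'] with u h1 h2
    rw [← h1]
    field_simp
    ring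
  -- With `c` fixed, the left side is constant in `u`: its derivative vanishes by the differential
  -- equations, and its limit at `0` is `℘(c)`.
  apply eventually_eq_of_tendsto_of_hasDerivAt_zero
  · filter_upwards [L.eventually_notMem_lattice 0, hcu, hne'] with u hu hv hd
    have hv' : HasDerivAt (fun u ↦ c - u) (-1) u := by simpa using (hasDerivAt_id u).const_sub c
    have h1 := L.hasDerivAt_weierstrassP hu
    have h2 := (L.hasDerivAt_weierstrassP hv).comp u hv'
    have h3 := L.hasDerivAt_derivWeierstrassP hu
    have h4 := (L.hasDerivAt_derivWeierstrassP hv).comp u hv'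
    have h5 := (((((h3.sub h4).div (h1.sub h2) hd).pow 2).div_const 4).sub h1).sub h2
    refine h5.congr_deriv ?_
    have e1 := L.derivWeierstrassP_sq u hu
    have e2 := L.derivWeierstrassP_sq _ hv
    simp only [Pi.sub_apply, Pi.div_apply, Function.comp_apply]
    generalize ℘[L] u = x₁ at *
    generalize ℘[L] (c - u) = x₂ at *
    generalize ℘'[L] u = y₁ at *
    generalize ℘'[L] (c - u) = y₂ at *
    have key : ((6 * x₁ ^ 2 - L.g₂ / 2 - (6 * x₂ ^ 2 - L.g₂ / 2) * -1) * (x₁ - x₂)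
        - (y₁ - y₂) * (y₁ - y₂ * -1)) / (x₁ - x₂) ^ 2 = 2 * (x₁ - x₂) := by
      rw [div_eq_iff (pow_ne_zero 2 hd)]
      linear_combination e2 - e1
    rw [key, Nat.cast_ofNat, show 2 - 1 = 1 from rfl, pow_one]
    linear_combination div_mul_cancel₀ (y₁ - y₂) hd
  -- Substituting the cubic for `℘'(u)²` cancels the leading pole; the rest is written in `1/℘` and
  -- `℘'/℘²`, which both tend to `0`.
  · have hlim : Tendsto (fun u ↦ (4 * ℘[L] (c - u) + (4 * ℘[L] (c - u) ^ 2 - L.g₂) * (℘[L] u)⁻¹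
        + (℘'[L] (c - u) ^ 2 - 4 * ℘[L] (c - u) ^ 3 - L.g₃) * (℘[L] u)⁻¹ ^ 2
        - 2 * ℘'[L] (c - u) * (℘'[L] u / ℘[L] u ^ 2)) / (4 * (1 - ℘[L] (c - u) * (℘[L] u)⁻¹) ^ 2)) (𝓝[≠] 0)
        (𝓝 ((4 * ℘[L] c + (4 * ℘[L] c ^ 2 - L.g₂) * 0
        + (℘'[L] c ^ 2 - 4 * ℘[L] c ^ 3 - L.g₃) * 0 ^ 2
        - 2 * ℘'[L] c * 0) / (4 * (1 - ℘[L] c * 0) ^ 2))) := by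
      refine Tendsto.div ?_ ?_ (by simp)
      · exact (((hx₂.const_mul 4).add ((((hx₂.pow 2).const_mul 4).sub_const _).mul ht)).add
          ((((hy₂.pow 2).sub ((hx₂.pow 3).const_mul 4)).sub_const _).mul (ht.pow 2))).sub
          ((hy₂.const_mul 2).mul hw)
      · exact ((tendsto_const_nhds.sub (hx₂.mul ht)).pow 2).const_mul 4
    have e : (4 * ℘[L] c + (4 * ℘[L] c ^ 2 - L.g₂) * 0
        + (℘'[L] c ^ 2 - 4 * ℘[L] c ^ 3 - L.g₃) * 0 ^ 2
        - 2 * ℘'[L] c * 0) / (4 * (1 - ℘[L] c * 0) ^ 2) = ℘[L] c := by ring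
    rw [e] at hlim
    refine hlim.congr' ?_
    filter_upwards [L.eventually_notMem_lattice 0, hne, hne',
      L.eventually_weierstrassP_ne h0 0] with u hu h1 h2 h3
    have e1 := L.derivWeierstrassP_sq u hu
    have e3 : 1 - ℘[L] (c - u) * (℘[L] u)⁻¹ = (℘[L] u - ℘[L] (c - u)) / ℘[L] u := by field_simp
    rw [e3]
    field_simp
    linear_combination -e1

/-- The addition formula for the Weierstrass function, with denominators cleared. -/
lemma weierstrassP_add {u v : ℂ} (hu : u ∉ L.lattice) (hv : v ∉ L.lattice)
    (huv : u + v ∉ L.lattice) :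
    4 * (℘[L] (u + v) + ℘[L] u + ℘[L] v) * (℘[L] u - ℘[L] v) ^ 2 = (℘'[L] u - ℘'[L] v) ^ 2 := by
  obtain ⟨c, rfl⟩ : ∃ c, v = c - u := ⟨u + v, by ring⟩
  rw [add_sub_cancel] at huv ⊢
  have h1 : Meromorphic fun u ↦ ℘[L] (c - u) :=
    L.meromorphic_weierstrassP.comp_analytic fun z ↦ by fun_prop
  have h2 : Meromorphic fun u ↦ ℘'[L] (c - u) :=
    L.meromorphic_derivWeierstrassP.comp_analytic fun z ↦ by fun_prop
  have hm : Meromorphic fun u ↦ 4 * (℘[L] c + ℘[L] u + ℘[L] (c - u)) * (℘[L] u - ℘[L] (c - u)) ^ 2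
      - (℘'[L] u - ℘'[L] (c - u)) ^ 2 := by fun_prop
  refine sub_eq_zero.1 (hm.eq_zero_of_frequently (x := 0) (Eventually.frequently ?_) ?_)
  · filter_upwards [L.eventually_addition_formula huv] with z hz
    rw [hz, sub_self]
  · have h3 := (L.analyticOnNhd_weierstrassP u hu).continuousAt
    have h4 := (L.analyticOnNhd_derivWeierstrassP u hu).continuousAt
    have h5 : ContinuousAt (fun u ↦ ℘[L] (c - u)) u :=
      ContinuousAt.comp (g := ℘[L]) (L.analyticOnNhd_weierstrassP _ hv).continuousAt (by fun_prop)
    have h6 : ContinuousAt (fun u ↦ ℘'[L] (c - u)) u :=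
      ContinuousAt.comp (g := ℘'[L]) (L.analyticOnNhd_derivWeierstrassP _ hv).continuousAt
        (by fun_prop)
    fun_prop

/-- The addition formulas for `v` and `-v` give the sum and product of the two roots, from which
`℘'` is eliminated. -/
lemma weierstrassP_addSub {u v : ℂ} (hu : u ∉ L.lattice) (hv : v ∉ L.lattice)
    (h₁ : u + v ∉ L.lattice) (h₂ : u - v ∉ L.lattice) (hne : ℘[L] u ≠ ℘[L] v) (T : ℂ) :
    (℘[L] (u + v) - T) * (℘[L] (u - v) - T) * (℘[L] u - ℘[L] v) ^ 2 =
      addSubPoly (-(L.g₂ / 4)) (-(L.g₃ / 4)) (℘[L] u) (℘[L] v) T := by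
  have e1 := L.weierstrassP_add hu hv h₁
  have e2 := L.weierstrassP_add hu (neg_mem_iff.not.2 hv) (by rwa [← sub_eq_add_neg])
  have e3 := L.derivWeierstrassP_sq u hu
  have e4 := L.derivWeierstrassP_sq v hv
  rw [← sub_eq_add_neg, L.weierstrassP_neg, L.derivWeierstrassP_neg] at e2
  have hd := sub_ne_zero.2 hne
  apply mul_right_cancel₀ (pow_ne_zero 2 hd)
  rw [addSubPoly]
  generalize ℘[L] (u + v) = P at *
  generalize ℘[L] (u - v) = M at *
  generalize ℘[L] u = x₁ at *
  generalize ℘[L] v = x₂ at *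
  generalize ℘'[L] u = y₁ at *
  generalize ℘'[L] v = y₂ at *
  linear_combination (x₁ - x₂) ^ 2 / 4 * (M + x₁ + x₂) * e1 + (y₁ - y₂) ^ 2 / 16 * e2
    + (y₁ ^ 2 - y₂ ^ 2 + (x₁ - x₂) * (4 * (x₁ ^ 2 + x₁ * x₂ + x₂ ^ 2) - L.g₂)) / 16 * (e3 - e4)
    - (T + x₁ + x₂) * (x₁ - x₂) ^ 2 / 4 * (e1 + e2)
    - (T + x₁ + x₂) * (x₁ - x₂) ^ 2 / 2 * (e3 + e4)

/-! ### The functions `℘(nz)` near `0` -/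

lemma tendsto_nat_mul_punctured {n : ℕ} (hn : n ≠ 0) (u : ℂ) :
    Tendsto (fun z : ℂ ↦ n * z) (𝓝[≠] u) (𝓝[≠] (n * u)) := by
  refine tendsto_nhdsWithin_of_tendsto_nhds_of_eventually_within _ ?_ ?_
  · have : ContinuousAt (fun z : ℂ ↦ n * z) u := by fun_prop
    exact this.tendsto.mono_left nhdsWithin_le_nhds
  · filter_upwards [self_mem_nhdsWithin] with z hz
    simpa [hn] using hz

lemma tendsto_sq_mul_weierstrassP : Tendsto (fun z ↦ z ^ 2 * ℘[L] z) (𝓝[≠] 0) (𝓝 1) := by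
  have h : ContinuousAt (fun z ↦ z ^ 2 * L.weierstrassPExcept 0 z + 1) 0 := by
    have := (L.analyticAt_weierstrassPExcept 0).continuousAt
    fun_prop
  have h' := h.tendsto.mono_left (nhdsWithin_le_nhds (s := {0}ᶜ))
  norm_num at h'
  refine h'.congr' ?_
  filter_upwards [self_mem_nhdsWithin] with z hz
  have := L.ite_eq_one_sub_sq_mul_weierstrassP 0 L.lattice.zero_mem z
  rw [if_neg (by simpa using hz)] at this
  simpa using this.symm

lemma tendsto_sq_mul_weierstrassP_nat_mul {n : ℕ} (hn : n ≠ 0) :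
    Tendsto (fun z ↦ z ^ 2 * ℘[L] (n * z)) (𝓝[≠] 0) (𝓝 (((n : ℂ) ^ 2)⁻¹)) := by
  have h := tendsto_nat_mul_punctured hn 0
  rw [mul_zero] at h
  have h' := (L.tendsto_sq_mul_weierstrassP.comp h).const_mul ((n : ℂ) ^ 2)⁻¹
  rw [mul_one] at h'
  refine h'.congr fun z ↦ ?_
  have : (n : ℂ) ≠ 0 := Nat.cast_ne_zero.2 hn
  simp only [Function.comp_apply]
  field_simp

lemma eventually_weierstrassP_nat_mul_ne {m n : ℕ} (hm : m ≠ 0) (hn : n ≠ 0) (hmn : m ≠ n) :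
    ∀ᶠ z in 𝓝[≠] 0, ℘[L] (m * z) ≠ ℘[L] (n * z) := by
  have h := (L.tendsto_sq_mul_weierstrassP_nat_mul hm).sub (L.tendsto_sq_mul_weierstrassP_nat_mul hn)
  refine (h.eventually_ne (b₂ := 0) ?_).mono fun z hz h' ↦ hz (by rw [h', sub_self])
  rw [sub_ne_zero, ne_eq, inv_inj]
  norm_cast
  simpa using hmn

lemma eventually_nat_mul_notMem_lattice {n : ℕ} (hn : n ≠ 0) (u : ℂ) :
    ∀ᶠ z in 𝓝[≠] u, (n : ℂ) * z ∉ L.lattice :=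
  (tendsto_nat_mul_punctured hn u).eventually (L.eventually_notMem_lattice _)

/-- The germs at `0` of the functions `℘[L] (n z)` satisfy the relations between the `x`-coordinates
of the multiples of a point. -/
lemma isMultipleSeq_germ (φ : Ultrafilter ℂ) (hφ : (φ : Filter ℂ) ≤ 𝓝[≠] 0) :
    IsMultipleSeq (K := Germ (φ : Filter ℂ) ℂ)
      (Germ.coeRingHom (φ : Filter ℂ) fun _ ↦ -(L.g₂ / 4))
      (Germ.coeRingHom (φ : Filter ℂ) fun _ ↦ -(L.g₃ / 4)) (Germ.coeRingHom (φ : Filter ℂ) ℘'[L])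
      fun n ↦ Germ.coeRingHom (φ : Filter ℂ) fun z ↦ ℘[L] (n * z) where
  y_ne_zero h := by
    have h1 : ∀ᶠ z in (φ : Filter ℂ), ℘'[L] z = 0 := Germ.coe_eq.1 h
    obtain ⟨z, hz, hz'⟩ :=
      (h1.and (hφ (L.eventually_derivWeierstrassP_ne_zero L.lattice.zero_mem))).exists
    exact hz' hz
  y_sq := by
    rw [← map_pow, ← map_pow, ← map_mul, ← map_add, ← map_add,
      ← map_ofNat (Germ.coeRingHom (φ : Filter ℂ)) 4, ← map_mul]
    refine Germ.coe_eq.2 (hφ ?_)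
    filter_upwards [L.eventually_notMem_lattice 0] with z hz
    simp only [Pi.pow_apply, Pi.mul_apply, Pi.add_apply, Pi.ofNat_apply, Nat.cast_one, one_mul]
    rw [L.derivWeierstrassP_sq z hz]
    ring
  ne n k hn hk h := by
    have h1 : ∀ᶠ z in (φ : Filter ℂ), ℘[L] (n * z) = ℘[L] ((n + k : ℕ) * z) := Germ.coe_eq.1 h
    obtain ⟨z, hz, hz'⟩ := (h1.and (hφ (L.eventually_weierstrassP_nat_mul_ne (m := n) (n := n + k)
      (by omega) (by omega) (by omega)))).exists
    exact hz' hz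
  addSub n k hn hk T := by
    obtain ⟨t, rfl⟩ : ∃ t : ℂ → ℂ, Germ.coeRingHom (φ : Filter ℂ) t = T :=
      T.inductionOn fun t ↦ ⟨t, rfl⟩
    rw [← map_addSubPoly, ← map_sub, ← map_sub, ← map_sub, ← map_pow, ← map_mul, ← map_mul]
    refine Germ.coe_eq.2 (hφ ?_)
    filter_upwards [L.eventually_nat_mul_notMem_lattice (n := n) (by omega) 0,
      L.eventually_nat_mul_notMem_lattice (n := n + k) (by omega) 0,
      L.eventually_nat_mul_notMem_lattice (n := 2 * n + k) (by omega) 0,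
      L.eventually_nat_mul_notMem_lattice (n := k) (by omega) 0,
      L.eventually_weierstrassP_nat_mul_ne (m := n + k) (n := n) (by omega) (by omega) (by omega)]
      with z h1 h2 h3 h4 h5
    have e1 : ((2 * n + k : ℕ) : ℂ) * z = (n + k : ℕ) * z + n * z := by push_cast; ring
    have e2 : (k : ℂ) * z = (n + k : ℕ) * z - n * z := by push_cast; ring
    rw [e1] at h3
    rw [e2] at h4
    have := L.weierstrassP_addSub h2 h1 h3 h4 h5 (t z)
    rw [← e1, ← e2] at this
    simpa [addSubPoly] using this

/-! ### Division polynomials at points of the curve -/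

/-- The curve `Y² = X³ - (g₂ / 4) X - g₃ / 4`. -/
noncomputable def curve : WeierstrassCurve ℂ := ⟨0, 0, 0, -(L.g₂ / 4), -(L.g₃ / 4)⟩

/-- The value of the `n`-th division polynomial at the point `(℘[L] z, ℘'[L] z / 2)`. -/
noncomputable def divisionValue (n : ℕ) (z : ℂ) : ℂ :=
  (L.curve.preΨ' n).eval (℘[L] z) * if Even n then ℘'[L] z else 1

lemma divisionValue_eq_normEDS (n : ℕ) {z : ℂ} (hz : z ∉ L.lattice) :
    L.divisionValue n z = normEDS (℘'[L] z) (L.curve.Ψ₃.eval (℘[L] z)) (L.curve.preΨ₄.eval (℘[L] z)) n := by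
  have h : L.curve.Ψ₂Sq.eval (℘[L] z) = ℘'[L] z ^ 2 := by
    rw [L.derivWeierstrassP_sq z hz]
    simp [WeierstrassCurve.Ψ₂Sq, curve, WeierstrassCurve.b₂, WeierstrassCurve.b₄,
      WeierstrassCurve.b₆]
    ring
  rw [normEDS_ofNat, divisionValue, WeierstrassCurve.preΨ', ← Polynomial.coe_evalRingHom,
    map_preNormEDS', map_pow, Polynomial.coe_evalRingHom, h, ← pow_mul]

lemma meromorphic_divisionValue (n : ℕ) : Meromorphic (L.divisionValue n) := by
  have h1 : Meromorphic fun z ↦ (L.curve.preΨ' n).eval (℘[L] z) := by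
    simp_rw [Polynomial.eval_eq_sum_range]
    fun_prop
  have h2 : Meromorphic fun z ↦ if Even n then ℘'[L] z else 1 := by
    split_ifs <;> fun_prop
  exact h1.mul h2

lemma continuousAt_divisionValue (n : ℕ) {u : ℂ} (hu : u ∉ L.lattice) :
    ContinuousAt (L.divisionValue n) u := by
  have h1 := (L.analyticOnNhd_weierstrassP u hu).continuousAt
  have h2 := (L.analyticOnNhd_derivWeierstrassP u hu).continuousAt
  have h3 : ContinuousAt (fun z ↦ if Even n then ℘'[L] z else 1) u := by
    split_ifs <;> fun_prop
  have h4 : ContinuousAt (fun z ↦ (L.curve.preΨ' n).eval (℘[L] z)) u :=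
    (L.curve.preΨ' n).continuous.continuousAt.comp h1
  exact h4.mul h3

lemma eventually_divisionValue (n : ℕ) (u : ℂ) : ∀ᶠ z in 𝓝[≠] u,
    L.divisionValue (n + 2) z * L.divisionValue n z =
      L.divisionValue (n + 1) z ^ 2 * (℘[L] z - ℘[L] ((n + 1 : ℕ) * z)) := by
  have hm : Meromorphic fun z ↦ L.divisionValue (n + 2) z * L.divisionValue n z -
      L.divisionValue (n + 1) z ^ 2 * (℘[L] z - ℘[L] ((n + 1 : ℕ) * z)) := by
    have h0 := L.meromorphic_divisionValue n
    have h1 := L.meromorphic_divisionValue (n + 1)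
    have h2 := L.meromorphic_divisionValue (n + 2)
    have h3 : Meromorphic fun z ↦ ℘[L] ((n + 1 : ℕ) * z) :=
      L.meromorphic_weierstrassP.comp_analytic fun z ↦ by fun_prop
    fun_prop
  suffices h : ∃ᶠ z in 𝓝[≠] 0, L.divisionValue (n + 2) z * L.divisionValue n z -
      L.divisionValue (n + 1) z ^ 2 * (℘[L] z - ℘[L] ((n + 1 : ℕ) * z)) = 0 from
    (hm.eventually_eq_zero_of_frequently h u).mono fun z ↦ sub_eq_zero.1
  -- Germs along an ultrafilter form a field, as `ratioSeq` requires; an identity there holds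
  -- frequently near `0`, which is enough.
  let φ : Ultrafilter ℂ := Ultrafilter.of (𝓝[≠] 0)
  have hφ : (φ : Filter ℂ) ≤ 𝓝[≠] 0 := Ultrafilter.of_le _
  have H := L.isMultipleSeq_germ φ hφ
  have hr := H.ratioSeq_rec n
  simp only [H.ratioSeq_eq_normEDS] at hr
  set F := Germ.coeRingHom (R := ℂ) (φ : Filter ℂ)
  let c : ℂ → ℂ := fun z ↦ L.curve.Ψ₃.eval (℘[L] z)
  let d : ℂ → ℂ := fun z ↦ L.curve.preΨ₄.eval (℘[L] z)
  have hc : 3 * (F fun z ↦ ℘[L] ((1 : ℕ) * z)) ^ 4 + 6 * (F fun _ ↦ -(L.g₂ / 4)) *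
      (F fun z ↦ ℘[L] ((1 : ℕ) * z)) ^ 2 + 12 * (F fun _ ↦ -(L.g₃ / 4)) *
      (F fun z ↦ ℘[L] ((1 : ℕ) * z)) - (F fun _ ↦ -(L.g₂ / 4)) ^ 2 = F c := by
    simp only [← map_pow, ← map_mul, ← map_add, ← map_sub, ← map_ofNat F 3, ← map_ofNat F 6,
      ← map_ofNat F 12]
    congr 1
    ext z
    simp [c, curve, WeierstrassCurve.Ψ₃, WeierstrassCurve.b₂, WeierstrassCurve.b₄,
      WeierstrassCurve.b₆, WeierstrassCurve.b₈]
    ring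
  have hd : 2 * ((F fun z ↦ ℘[L] ((1 : ℕ) * z)) ^ 6 + 5 * (F fun _ ↦ -(L.g₂ / 4)) *
      (F fun z ↦ ℘[L] ((1 : ℕ) * z)) ^ 4 + 20 * (F fun _ ↦ -(L.g₃ / 4)) *
      (F fun z ↦ ℘[L] ((1 : ℕ) * z)) ^ 3 - 5 * (F fun _ ↦ -(L.g₂ / 4)) ^ 2 *
      (F fun z ↦ ℘[L] ((1 : ℕ) * z)) ^ 2 - 4 * (F fun _ ↦ -(L.g₂ / 4)) * (F fun _ ↦ -(L.g₃ / 4)) *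
      (F fun z ↦ ℘[L] ((1 : ℕ) * z)) - 8 * (F fun _ ↦ -(L.g₃ / 4)) ^ 2
      - (F fun _ ↦ -(L.g₂ / 4)) ^ 3) = F d := by
    simp only [← map_pow, ← map_mul, ← map_add, ← map_sub, ← map_ofNat F 2, ← map_ofNat F 5,
      ← map_ofNat F 20, ← map_ofNat F 4, ← map_ofNat F 8]
    congr 1
    ext z
    simp [d, curve, WeierstrassCurve.preΨ₄, WeierstrassCurve.b₂, WeierstrassCurve.b₄,
      WeierstrassCurve.b₆, WeierstrassCurve.b₈]
    ring
  rw [hc, hd, ← map_normEDS, ← map_normEDS, ← map_normEDS, ← map_sub, ← map_pow, ← map_mul,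
    ← map_mul] at hr
  have hr' := Germ.coe_eq.1 hr
  refine Frequently.filter_mono (Eventually.frequently ?_) hφ
  filter_upwards [hr', hφ (L.eventually_notMem_lattice 0)] with z hz hzL
  have hev (k : ℕ) : normEDS ℘'[L] c d k z = L.divisionValue k z := by
    rw [L.divisionValue_eq_normEDS k hzL]
    exact map_normEDS (Pi.evalRingHom (fun _ : ℂ ↦ ℂ) z) _ _ _ _
  simp only [Pi.mul_apply, Pi.pow_apply, Pi.sub_apply, hev, Nat.cast_one, one_mul] at hz
  rw [hz, sub_self]

/-- The `m`-th division polynomial vanishes at the `m`-division points. -/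
lemma divisionValue_eq_zero {m : ℕ} (hm : m ≠ 0) {u : ℂ} (hu : u ∉ L.lattice)
    (hmu : (m : ℂ) * u ∈ L.lattice) : L.divisionValue m u = 0 := by
  obtain ⟨n, rfl⟩ := Nat.exists_eq_succ_of_ne_zero hm
  have hcont (k : ℕ) : Tendsto (L.divisionValue k) (𝓝[≠] u) (𝓝 (L.divisionValue k u)) :=
    (L.continuousAt_divisionValue k hu).tendsto.mono_left nhdsWithin_le_nhds
  have hP : Tendsto ℘[L] (𝓝[≠] u) (𝓝 (℘[L] u)) :=
    (L.analyticOnNhd_weierstrassP u hu).continuousAt.tendsto.mono_left nhdsWithin_le_nhds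
  have ht := (L.tendsto_inv_weierstrassP hmu).comp (tendsto_nat_mul_punctured hm u)
  have hne := (tendsto_nat_mul_punctured hm u).eventually (L.eventually_weierstrassP_ne hmu 0)
  -- Both sides of the relation are divided by `℘((n+1)z)`, whose inverse tends to `0`.
  have h1 := ((hcont (n + 2)).mul (hcont n)).mul ht
  have h2 := ((hcont (n + 1)).pow 2).mul ((hP.mul ht).sub_const 1)
  have h3 := tendsto_nhds_unique (h1.congr' ?_) h2
  · simpa using h3
  · filter_upwards [hne, L.eventually_divisionValue n u] with z hz h
    simp only [Function.comp_apply]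
    rw [h, mul_assoc, sub_mul, mul_inv_cancel₀ hz]

end PeriodPair

/-! ### Integrality -/

theorem mainTheorem10 (L : PeriodPair) (m : ℕ) (hm : 0 < m) (u : ℂ)
    (hu : u ∉ L.lattice) (hmu : (m : ℂ) * u ∈ L.lattice) :
    IsIntegral (Algebra.adjoin ℤ {L.g₂ / 4, L.g₃ / 4} : Subalgebra ℤ ℂ)
        ((m : ℂ) * L.weierstrassP u) ∧
      (Even m →
        IsIntegral (Algebra.adjoin ℤ {L.g₂ / 4, L.g₃ / 4} : Subalgebra ℤ ℂ)
          ((m : ℂ) / 2 * L.weierstrassP u)) := by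
  set R : Subalgebra ℤ ℂ := Algebra.adjoin ℤ {L.g₂ / 4, L.g₃ / 4}
  let h₂ : R := ⟨L.g₂ / 4, Algebra.subset_adjoin (by simp)⟩
  let h₃ : R := ⟨L.g₃ / 4, Algebra.subset_adjoin (by simp)⟩
  let W : WeierstrassCurve R := ⟨0, 0, 0, -h₂, -h₃⟩
  have hW : W.map (algebraMap R ℂ) = L.curve := by
    ext <;> simp [W, PeriodPair.curve, WeierstrassCurve.map] <;> rfl
  have hmR : (m : R) ≠ 0 := fun h ↦ hm.ne' (by exact_mod_cast congrArg (algebraMap R ℂ) h)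
  have hz := L.divisionValue_eq_zero hm.ne' hu hmu
  rw [PeriodPair.divisionValue, ← hW, WeierstrassCurve.map_preΨ', Polynomial.eval_map_algebraMap]
    at hz
  have hint : Polynomial.aeval (L.weierstrassP u) (W.preΨ' m) = 0 →
      IsIntegral R (((if Even m then m / 2 else m : ℕ) : ℂ) * L.weierstrassP u) := fun h ↦ by
    have := isIntegral_leadingCoeff_smul _ _ h
    rw [W.leadingCoeff_preΨ' hmR] at this
    rwa [Algebra.smul_def, map_natCast] at this
  rcases m.even_or_odd with he | ho
  · have key : IsIntegral R ((m : ℂ) / 2 * L.weierstrassP u) := by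
      rw [if_pos he, mul_eq_zero] at hz
      rcases hz with hz | hz
      · have := hint hz
        rwa [if_pos he, Nat.cast_div_charZero he.two_dvd, Nat.cast_ofNat] at this
      -- Here `℘'(u) = 0`, so `℘(u)` is a root of `X³ - h₂ X - h₃`.
      · have hx : IsIntegral R (L.weierstrassP u) := by
          refine ⟨Polynomial.X ^ 3 - (Polynomial.C h₂ * Polynomial.X + Polynomial.C h₃), ?_, ?_⟩
          · exact Polynomial.monic_X_pow_sub (by compute_degree; norm_num)
          · have := L.derivWeierstrassP_sq u hu
            rw [hz] at this
            simp only [Polynomial.eval₂_sub, Polynomial.eval₂_add, Polynomial.eval₂_mul,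
              Polynomial.eval₂_pow, Polynomial.eval₂_X, Polynomial.eval₂_C]
            change _ - (L.g₂ / 4 * _ + L.g₃ / 4) = 0
            linear_combination -this / 4
        obtain ⟨k, rfl⟩ := he.two_dvd
        rw [Nat.cast_mul, Nat.cast_ofNat, mul_div_cancel_left₀ _ two_ne_zero]
        exact (isIntegral_natCast k).mul hx
    refine ⟨?_, fun _ ↦ key⟩
    have := key.add key
    rwa [← add_mul, add_halves] at this
  · have he := Nat.not_even_iff_odd.2 ho
    rw [if_neg he, mul_one] at hz
    have := hint hz
    rw [if_neg he] at this
    exact ⟨this, fun h ↦ absurd h he⟩
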